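/- Let $(X,\mathsf d_X)$ be a nonempty compact metric space, and let $\mathfrak A$ be a unital C*-algebra with a faithful tracial state $\tau$ and finite-dimensional C*-subalgebras $\mathfrak A_0=\mathbb C1_{\mathfrak A}\subseteq \mathfrak A_1\subseteq \mathfrak A_2\subseteq\cdots$ whose union is dense in $\mathfrak A$. Put $\mathcal I=(\mathfrak A_n)_{n\in\mathbb N}$, and let $(\beta(n))_{n\in\mathbb N}$ be a sequence of positive real numbers converging to $0$. For each $n$ let $E_n:\mathfrak A\to\mathfrak A_n$ be the unique $\tau$-preserving conditional expectation onto $\mathfrak A_n$. Define $$\mathsf L^\beta_{\mathcal I,\tau}(a)=\sup_{n}\frac{\|a-E_n(a)\|_{\mathfrak A}}{\beta(n)}\qquad (a\in \bigcup_n\mathfrak A_n \text{ self-adjoint}),$$ $$l_{\mathsf d_X}^{\mathfrak A}(f)=\sup_{x,y\in X}\frac{\|f(x)-f(y)\|_{\mathfrak A}}{\mathsf d_X(x,y)}\ \ (\text{with } 0/0=0),\qquad \mathsf L(f)=l_{\mathsf d_X}^{\mathfrak A}(f)+\sup_n\frac{\sup_{x\in X}\|f(x)-E_n(f(x))\|_{\mathfrak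 A}}{\beta(n)}$$ for self-adjoint $f\in C(X,\mathfrak A)$, and let $l^{\mathbb C}_{\mathsf d_X}$ be the usual Lipschitz seminorm on the self-adjoint part of $C(X)$. Let $\mathsf L^{\otimes}=\mathsf L\circ\pi$ on the self-adjoint part of the C*-algebraic tensor product $C(X)\otimes\mathfrak A$, where $\pi:C(X)\otimes\mathfrak A\to C(X,\mathfrak A)$ is the canonical *-isomorphism with $\pi(f\otimes a)(x)=f(x)a$. For a seminorm $L$ on (a subspace of) the self-adjoint part of a unital C*-algebra $\mathfrak B$ with state space $\mathscr S(\mathfrak B)$, let $\mathsf{mk}_L(\varphi,\psi)=\sup\{|\varphi(b)-\psi(b)| : b=b^*,\ L(b)\le 1\}$ be the Monge–Kantorovich metric on $\mathscr S(\mathfrak B)$. On a product of two metric spaces let $\mathsf d^1$ be the $1$-metric, i.e. the sum of the two distances. Then $$\begin{aligned}\operatorname{diam}\bigl(\mathscr S(C(X)\otimes\mathfrak A),\mathsf{mk}_{\mathsf L^{\otimes}}\bigr)&\le \operatorname{diam}\bigl(\mathscr S(C(X))\times\mathscr S(\mathfrak A),\ \mathsf d^1_{\mathsf{mk}_{l^{\mathbb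 C}_{\mathsf d_X}}\times\,\mathsf{mk}_{\mathsf L^\beta_{\mathcal I,\tau}}}\bigr)\\&=\operatorname{diam}\bigl(\mathscr S(C(X)),\mathsf{mk}_{l^{\mathbb C}_{\mathsf d_X}}\bigr)+\operatorname{diam}\bigl(\mathscr S(\mathfrak A),\mathsf{mk}_{\mathsf L^\beta_{\mathcal I,\tau}}\bigr)\\&=\operatorname{diam}(X,\mathsf d_X)+\operatorname{diam}\bigl(\mathscr S(\mathfrak A),\mathsf{mk}_{\mathsf L^\beta_{\mathcal I,\tau}}\bigr)\\&\le\operatorname{diam}(X,\mathsf d_X)+2\beta(0),\end{aligned}$$ and the same holds with $\bigl(\mathscr S(C(X)\otimes\mathfrak A),\mathsf{mk}_{\mathsf L^{\otimes}}\bigr)$ replaced by $\bigl(\mathscr S(C(X,\mathfrak A)),\mathsf{mk}_{\mathsf L}\bigr)$. Moreover, for every state $\psi$ of $\mathfrak A$ and all $x,y\in X$, the states $\psi_x:f\mapsto\psi(f(x))$ and $\psi_y$ of $C(X,\mathfrak A)$ satisfy $$\mathsf{mk}_{\mathsf L}(\psi_x,\psi_y)=\mathsf d_X(x,y)=\mathsf{mk}_{\mathsf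 L^{\otimes}}(\psi_x\circ\pi,\psi_y\circ\pi),$$ so that $x\mapsto\psi_x$ and $x\mapsto\psi_x\circ\pi$ are isometries of $X$ into the two state spaces. -/

import Mathlib

open scoped TensorProduct ENNReal ComplexOrder Topology

universe u v w

noncomputable section

/-! ## C*-seminorms on complex *-algebras and their completions -/

/-- A C*-seminorm on a unital complex *-algebra: a submultiplicative seminorm satisfying the
C*-identity. -/
structure CStarSeminorm (R : Type u) [Ring R] [StarRing R] [Algebra ℂ R] [StarModule ℂ R] extends
    Seminorm ℂ R where
  mul_le' : ∀ x y : R, toFun (x * y) ≤ toFun x * toFun y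
  star_mul_self' : ∀ x : R, toFun (star x * x) = toFun x * toFun x

namespace CStarSeminorm

section Basic

variable {R : Type u} [Ring R] [StarRing R] [Algebra ℂ R] [StarModule ℂ R]

instance : CoeFun (CStarSeminorm R) (fun _ => R → ℝ) := ⟨fun p => p.toSeminorm⟩

theorem mul_le (p : CStarSeminorm R) (x y : R) : p (x * y) ≤ p x * p y := p.mul_le' x y

theorem star_mul_self (p : CStarSeminorm R) (x : R) : p (star x * x) = p x * p x :=
  p.star_mul_self' x

theorem nonneg (p : CStarSeminorm R) (x : R) : 0 ≤ p x := apply_nonneg p.toSeminorm x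

theorem le_star (p : CStarSeminorm R) (x : R) : p x ≤ p (star x) := by
  rcases (p.nonneg x).eq_or_lt with h | h
  · rw [← h]; exact p.nonneg _
  · have h1 : p x * p x ≤ p (star x) * p x := (p.star_mul_self x).symm.le.trans (p.mul_le _ _)
    exact le_of_mul_le_mul_right h1 h

theorem star_eq (p : CStarSeminorm R) (x : R) : p (star x) = p x :=
  le_antisymm (by simpa using p.le_star (star x)) (p.le_star x)

/-- Pulling back a C*-seminorm along a unital *-homomorphism. -/
def comap {S : Type v} [Ring S] [StarRing S] [Algebra ℂ S] [StarModule ℂ S]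
    (p : CStarSeminorm R) (φ : S →⋆ₐ[ℂ] R) : CStarSeminorm S where
  toSeminorm := p.toSeminorm.comp φ.toAlgHom.toLinearMap
  mul_le' x y := by
    change p (φ (x * y)) ≤ p (φ x) * p (φ y)
    rw [map_mul]; exact p.mul_le _ _
  star_mul_self' x := by
    change p (φ (star x * x)) = p (φ x) * p (φ x)
    rw [map_mul, map_star]; exact p.star_mul_self _

theorem comap_apply {S : Type v} [Ring S] [StarRing S] [Algebra ℂ S] [StarModule ℂ S]
    (p : CStarSeminorm R) (φ : S →⋆ₐ[ℂ] R) (x : S) : p.comap φ x = p (φ x) := rfl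

/-- A copy of `R`, to be equipped with the topology of the C*-seminorm `p`. -/
def Pre (_p : CStarSeminorm R) : Type u := R

variable (p : CStarSeminorm R)

instance : Ring p.Pre := inferInstanceAs (Ring R)
instance : StarRing p.Pre := inferInstanceAs (StarRing R)
instance : Algebra ℂ p.Pre := inferInstanceAs (Algebra ℂ R)
instance : StarModule ℂ p.Pre := inferInstanceAs (StarModule ℂ R)

instance : SeminormedRing p.Pre where
  __ := (inferInstance : Ring p.Pre)
  __ := p.toSeminorm.toAddGroupSeminorm.toSeminormedAddCommGroup
  norm_mul_le x y := p.mul_le x y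

theorem norm_pre (x : p.Pre) : ‖x‖ = p x := rfl

instance : NormedAlgebra ℂ p.Pre where
  __ := (inferInstance : Algebra ℂ p.Pre)
  norm_smul_le c x := (map_smul_eq_mul p.toSeminorm c x).le

instance : NormedStarGroup p.Pre where
  norm_star_le x := (p.star_eq x).le

/-- The Hausdorff completion of `R` for the C*-seminorm `p`; it is a unital C*-algebra. -/
def Completion : Type u := UniformSpace.Completion p.Pre

namespace Completion

instance : NormedRing p.Completion := inferInstanceAs (NormedRing (UniformSpace.Completion p.Pre))
instance : CompleteSpace p.Completion :=
  inferInstanceAs (CompleteSpace (UniformSpace.Completion p.Pre))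
instance : Algebra ℂ p.Completion :=
  inferInstanceAs (Algebra ℂ (UniformSpace.Completion p.Pre))

instance : NormedAlgebra ℂ p.Completion where
  norm_smul_le c x := norm_smul_le (β := UniformSpace.Completion p.Pre) c x

/-- The canonical map from `R` to its completion. -/
def mk (x : R) : p.Completion := UniformSpace.Completion.coe' (α := p.Pre) x

theorem norm_mk (x : R) : ‖mk p x‖ = p x := UniformSpace.Completion.norm_coe (E := p.Pre) x

theorem denseRange_mk : DenseRange (mk p) :=
  UniformSpace.Completion.denseRange_coe (α := p.Pre)

theorem mk_add (x y : R) : mk p (x + y) = mk p x + mk p y :=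
  UniformSpace.Completion.coe_add (α := p.Pre) x y

theorem mk_mul (x y : R) : mk p (x * y) = mk p x * mk p y :=
  UniformSpace.Completion.coe_mul (α := p.Pre) x y

theorem mk_smul (c : ℂ) (x : R) : mk p (c • x) = c • mk p x :=
  UniformSpace.Completion.coe_smul (X := p.Pre) c x

theorem mk_one : mk p 1 = 1 := rfl

instance : Star p.Completion :=
  ⟨UniformSpace.Completion.map (star : p.Pre → p.Pre)⟩

theorem uniformContinuous_star_pre : UniformContinuous (star : p.Pre → p.Pre) :=
  star_isometry.uniformContinuous

theorem continuous_star' : Continuous (star : p.Completion → p.Completion) :=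
  UniformSpace.Completion.continuous_map

theorem mk_star (x : R) : mk p (star x) = star (mk p x) :=
  (UniformSpace.Completion.map_coe (uniformContinuous_star_pre p) (x : p.Pre)).symm

theorem induction {P : p.Completion → Prop} (hc : IsClosed {x | P x}) (h : ∀ x, P (mk p x))
    (x : p.Completion) : P x :=
  UniformSpace.Completion.induction_on (α := p.Pre) x hc h

theorem induction₂ {P : p.Completion → p.Completion → Prop}
    (hc : IsClosed {x : p.Completion × p.Completion | P x.1 x.2})
    (h : ∀ x y, P (mk p x) (mk p y)) (x y : p.Completion) : P x y :=
  UniformSpace.Completion.induction_on₂ (α := p.Pre) (β := p.Pre) x y hc h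

instance : StarRing p.Completion where
  star_involutive x := by
    refine induction p (P := fun x => star (star x) = x)
      (isClosed_eq ((continuous_star' p).comp (continuous_star' p)) continuous_id) (fun x => ?_) x
    rw [← mk_star, ← mk_star, star_star]
  star_mul x y := by
    refine induction₂ p (P := fun x y => star (x * y) = star y * star x)
      (isClosed_eq ((continuous_star' p).comp continuous_mul)
      (((continuous_star' p).comp continuous_snd).mul ((continuous_star' p).comp continuous_fst)))
      (fun x y => ?_) x y
    rw [← mk_mul, ← mk_star, ← mk_star, ← mk_star, ← mk_mul, star_mul]
  star_add x y := by
    refine induction₂ p (P := fun x y => star (x + y) = star x + star y)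
      (isClosed_eq ((continuous_star' p).comp continuous_add)
      (((continuous_star' p).comp continuous_fst).add ((continuous_star' p).comp continuous_snd)))
      (fun x y => ?_) x y
    rw [← mk_add, ← mk_star, ← mk_star, ← mk_star, ← mk_add, star_add]

instance : StarModule ℂ p.Completion where
  star_smul c x := by
    refine induction p (P := fun x => star (c • x) = star c • star x)
      (isClosed_eq ((continuous_star' p).comp (continuous_const_smul c))
      ((continuous_star' p).const_smul (star c))) (fun x => ?_) x
    rw [← mk_smul, ← mk_star, ← mk_star, ← mk_smul, star_smul]

instance : CStarRing p.Completion where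
  norm_mul_self_le x := by
    refine induction p (P := fun x => ‖x‖ * ‖x‖ ≤ ‖star x * x‖)
      (isClosed_le (continuous_norm.mul continuous_norm)
        (((continuous_star' p).mul continuous_id).norm)) (fun x => ?_) x
    rw [← mk_star, ← mk_mul, norm_mk, norm_mk, star_mul_self]

instance : CStarAlgebra p.Completion where

/-- The canonical unital *-homomorphism from `R` to its completion. -/
def ofStarAlg : R →⋆ₐ[ℂ] p.Completion where
  toFun := mk p
  map_one' := mk_one p
  map_mul' := mk_mul p
  map_zero' := by simpa using mk_smul p 0 0
  map_add' := mk_add p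
  commutes' c := by
    rw [Algebra.algebraMap_eq_smul_one, mk_smul, mk_one, Algebra.algebraMap_eq_smul_one]
  map_star' := mk_star p

section Lift

variable {p} {D : Type v} [CStarAlgebra D] (φ : R →⋆ₐ[ℂ] D)

/-- `φ` as a map out of the seminormed algebra `p.Pre`. -/
def preMap : p.Pre → D := fun x => φ (x : R)

theorem uniformContinuous_preMap (hφ : ∀ x, ‖φ x‖ ≤ p x) : UniformContinuous (preMap φ : p.Pre → D) := by
  refine LipschitzWith.uniformContinuous (K := 1) (LipschitzWith.of_dist_le_mul fun x y => ?_)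
  rw [dist_eq_norm, dist_eq_norm, NNReal.coe_one, one_mul, norm_pre]
  have : preMap φ x - preMap φ y = φ ((x - y : p.Pre) : R) := (map_sub φ (x : R) (y : R)).symm
  rw [this]
  exact hφ _

/-- The continuous extension of `φ` to the completion. -/
def liftFun (φ : R →⋆ₐ[ℂ] D) : p.Completion → D :=
  UniformSpace.Completion.extension (preMap φ : p.Pre → D)

theorem continuous_liftFun : Continuous (liftFun φ : p.Completion → D) :=
  UniformSpace.Completion.continuous_extension

theorem liftFun_mk (hφ : ∀ x, ‖φ x‖ ≤ p x) (x : R) : liftFun φ (mk p x) = φ x :=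
  UniformSpace.Completion.extension_coe (uniformContinuous_preMap φ hφ) (x : p.Pre)

/-- A unital *-homomorphism into a C*-algebra which is dominated by `p` extends by continuity to
the completion. -/
def lift (hφ : ∀ x, ‖φ x‖ ≤ p x) : p.Completion →⋆ₐ[ℂ] D where
  toFun := liftFun φ
  map_one' := by rw [← mk_one, liftFun_mk φ hφ, map_one]
  map_zero' := by
    rw [show (0 : p.Completion) = mk p 0 from (map_zero (ofStarAlg p)).symm, liftFun_mk φ hφ,
      map_zero]
  map_mul' x y := by
    have hc := continuous_liftFun (p := p) φ
    refine induction₂ p (P := fun x y => liftFun φ (x * y) = liftFun φ x * liftFun φ y)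
      (isClosed_eq (hc.comp continuous_mul)
        ((hc.comp continuous_fst).mul (hc.comp continuous_snd))) (fun x y => ?_) x y
    rw [← mk_mul, liftFun_mk φ hφ, liftFun_mk φ hφ, liftFun_mk φ hφ, map_mul]
  map_add' x y := by
    have hc := continuous_liftFun (p := p) φ
    refine induction₂ p (P := fun x y => liftFun φ (x + y) = liftFun φ x + liftFun φ y)
      (isClosed_eq (hc.comp continuous_add)
        ((hc.comp continuous_fst).add (hc.comp continuous_snd))) (fun x y => ?_) x y
    rw [← mk_add, liftFun_mk φ hφ, liftFun_mk φ hφ, liftFun_mk φ hφ, map_add]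
  commutes' c := by
    rw [Algebra.algebraMap_eq_smul_one, ← mk_one, ← mk_smul, liftFun_mk φ hφ, map_smul, map_one,
      Algebra.algebraMap_eq_smul_one]
  map_star' x := by
    have hc := continuous_liftFun (p := p) φ
    refine induction p (P := fun x => liftFun φ (star x) = star (liftFun φ x))
      (isClosed_eq (hc.comp (continuous_star' p)) (continuous_star.comp hc)) (fun x => ?_) x
    rw [← mk_star, liftFun_mk φ hφ, liftFun_mk φ hφ, map_star]

theorem lift_mk (hφ : ∀ x, ‖φ x‖ ≤ p x) (x : R) : lift φ hφ (mk p x) = φ x := liftFun_mk φ hφ x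

end Lift

end Completion

end Basic

/-- Every C*-seminorm on a C*-algebra is dominated by the norm. -/
theorem le_norm {B : Type u} [CStarAlgebra B] (p : CStarSeminorm B) (b : B) : p b ≤ ‖b‖ := by
  rw [← Completion.norm_mk p b]
  exact NonUnitalStarAlgHom.norm_apply_le (Completion.ofStarAlg p) b

/-- The norm of a C*-algebra, as a C*-seminorm. -/
def ofNorm (B : Type u) [CStarAlgebra B] : CStarSeminorm B where
  toSeminorm := normSeminorm ℂ B
  mul_le' := norm_mul_le
  star_mul_self' _ := CStarRing.norm_star_mul_self

end CStarSeminorm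

/-! ## The C*-algebraic tensor product -/

section Tensor

variable (B : Type u) (A : Type v) [CStarAlgebra B] [CStarAlgebra A]

instance : StarModule ℂ (B ⊗[ℂ] A) where
  star_smul c t := by
    induction t with
    | zero => simp
    | tmul b a => simp [TensorProduct.smul_tmul']
    | add x y hx hy => rw [smul_add, star_add, hx, hy, star_add, smul_add]

variable {B A}

theorem CStarSeminorm.tmul_le (p : CStarSeminorm (B ⊗[ℂ] A)) (b : B) (a : A) :
    p (b ⊗ₜ[ℂ] a) ≤ ‖b‖ * ‖a‖ := by
  let iB : B →⋆ₐ[ℂ] B ⊗[ℂ] A :=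
    { (Algebra.TensorProduct.includeLeft : B →ₐ[ℂ] B ⊗[ℂ] A) with
      map_star' := fun x => by simp }
  let iA : A →⋆ₐ[ℂ] B ⊗[ℂ] A :=
    { (Algebra.TensorProduct.includeRight : A →ₐ[ℂ] B ⊗[ℂ] A) with
      map_star' := fun x => by simp }
  have h : b ⊗ₜ[ℂ] a = iB b * iA a := by
    change b ⊗ₜ[ℂ] a = (b ⊗ₜ[ℂ] (1 : A)) * ((1 : B) ⊗ₜ[ℂ] a)
    simp
  rw [h]
  exact (p.mul_le _ _).trans (mul_le_mul ((p.comap iB).le_norm b) ((p.comap iA).le_norm a)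
    (p.nonneg _) (norm_nonneg _))

theorem CStarSeminorm.bddAbove_tensor (t : B ⊗[ℂ] A) :
    BddAbove (Set.range fun p : CStarSeminorm (B ⊗[ℂ] A) => p t) := by
  induction t with
  | zero => exact ⟨0, by rintro _ ⟨p, rfl⟩; exact (map_zero p.toSeminorm).le⟩
  | tmul b a => exact ⟨‖b‖ * ‖a‖, by rintro _ ⟨p, rfl⟩; exact p.tmul_le b a⟩
  | add x y hx hy =>
    obtain ⟨C, hC⟩ := hx
    obtain ⟨D, hD⟩ := hy
    refine ⟨C + D, ?_⟩
    rintro _ ⟨p, rfl⟩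
    exact (map_add_le_add p.toSeminorm x y).trans (add_le_add (hC ⟨p, rfl⟩) (hD ⟨p, rfl⟩))

/-- The zero C*-seminorm. -/
instance : Nonempty (CStarSeminorm (B ⊗[ℂ] A)) :=
  ⟨{ toSeminorm := 0, mul_le' := fun _ _ => by
        change (0 : ℝ) ≤ 0 * 0; simp
     star_mul_self' := fun _ => by
        change (0 : ℝ) = 0 * 0; simp }⟩

variable (B A)

/-- The largest C*-norm on the algebraic tensor product: the supremum of all C*-seminorms. -/
def maxCStarSeminorm : CStarSeminorm (B ⊗[ℂ] A) where
  toFun t := ⨆ p : CStarSeminorm (B ⊗[ℂ] A), p t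
  map_zero' := by
    have : ∀ p : CStarSeminorm (B ⊗[ℂ] A), p 0 = 0 := fun p => map_zero p.toSeminorm
    simp [this]
  add_le' x y := ciSup_le fun p => (map_add_le_add p.toSeminorm x y).trans
    (add_le_add (le_ciSup (CStarSeminorm.bddAbove_tensor x) p)
      (le_ciSup (CStarSeminorm.bddAbove_tensor y) p))
  neg' x := by
    have : ∀ p : CStarSeminorm (B ⊗[ℂ] A), p (-x) = p x := fun p => map_neg_eq_map p.toSeminorm x
    simp [this]
  smul' c x := by
    have : ∀ p : CStarSeminorm (B ⊗[ℂ] A), p (c • x) = ‖c‖ * p x :=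
      fun p => map_smul_eq_mul p.toSeminorm c x
    simp only [this]
    exact (Real.mul_iSup_of_nonneg (norm_nonneg c) _).symm
  mul_le' x y := ciSup_le fun p => (p.mul_le x y).trans
    (mul_le_mul (le_ciSup (CStarSeminorm.bddAbove_tensor x) p)
      (le_ciSup (CStarSeminorm.bddAbove_tensor y) p) (p.nonneg y)
      (Real.iSup_nonneg fun q => q.nonneg x))
  star_mul_self' x := by
    have h0 : 0 ≤ ⨆ p : CStarSeminorm (B ⊗[ℂ] A), p x := Real.iSup_nonneg fun q => q.nonneg x
    apply le_antisymm
    · refine ciSup_le fun p => (p.star_mul_self x).le.trans ?_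
      exact mul_le_mul (le_ciSup (CStarSeminorm.bddAbove_tensor x) p)
        (le_ciSup (CStarSeminorm.bddAbove_tensor x) p) (p.nonneg x) h0
    · have h1 : (⨆ p : CStarSeminorm (B ⊗[ℂ] A), p x) ≤
          √(⨆ p : CStarSeminorm (B ⊗[ℂ] A), p (star x * x)) := by
        refine ciSup_le fun p => Real.le_sqrt_of_sq_le ?_
        rw [sq, ← p.star_mul_self x]
        exact le_ciSup (CStarSeminorm.bddAbove_tensor (star x * x)) p
      calc _ ≤ _ := mul_le_mul h1 h1 h0 (Real.sqrt_nonneg _)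
        _ = _ := Real.mul_self_sqrt (Real.iSup_nonneg fun q => q.nonneg _)

/-- The C*-algebraic tensor product of two unital C*-algebras: the completion of the algebraic
tensor product in its largest C*-norm. (When one of the factors is commutative, hence nuclear, the
C*-norm on the algebraic tensor product is unique, so that this is the only C*-tensor product.) -/
abbrev CStarTensor : Type (max u v) := (maxCStarSeminorm B A).Completion

end Tensor

/-! ## States and Monge-Kantorovich distances -/

/-- The state space of a unital C*-algebra: the positive linear functionals `φ` with `φ 1 = 1`. -/
structure StateSpace (A : Type u) [CStarAlgebra A] where
  toLinearMap : A →ₗ[ℂ] ℂ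
  map_one' : toLinearMap 1 = 1
  nonneg' : ∀ a : A, 0 ≤ toLinearMap (star a * a)

namespace StateSpace

instance (A : Type u) [CStarAlgebra A] : CoeFun (StateSpace A) (fun _ => A → ℂ) :=
  ⟨fun φ => φ.toLinearMap⟩

/-- The state `φ ∘ π`, for a unital *-homomorphism `π`. -/
def comap {A : Type u} {B : Type v} [CStarAlgebra A] [CStarAlgebra B] (φ : StateSpace B)
    (π : A →⋆ₐ[ℂ] B) : StateSpace A where
  toLinearMap := φ.toLinearMap ∘ₗ π.toAlgHom.toLinearMap
  map_one' := by
    change φ (π 1) = 1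
    rw [map_one]; exact φ.map_one'
  nonneg' a := by
    change 0 ≤ φ (π (star a * a))
    rw [map_mul, map_star]; exact φ.nonneg' _

/-- The state `ψ_x : f ↦ ψ (f x)` of `C(X, A)`, for a state `ψ` of `A` and a point `x` of `X`. -/
def atPoint {X : Type u} [TopologicalSpace X] [CompactSpace X] {A : Type v} [CStarAlgebra A]
    (ψ : StateSpace A) (x : X) : StateSpace C(X, A) where
  toLinearMap :=
    { toFun := fun f => ψ (f x)
      map_add' := fun f g => map_add ψ.toLinearMap (f x) (g x)
      map_smul' := fun c f => map_smul ψ.toLinearMap c (f x) }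
  map_one' := ψ.map_one'
  nonneg' f := ψ.nonneg' (f x)

/-- A state `τ` is tracial if `τ (a b) = τ (b a)` for all `a`, `b`. -/
def IsTracial {A : Type u} [CStarAlgebra A] (τ : StateSpace A) : Prop :=
  ∀ a b : A, τ (a * b) = τ (b * a)

/-- A state `τ` is faithful if `τ (a* a) = 0` only for `a = 0`. -/
def IsFaithful {A : Type u} [CStarAlgebra A] (τ : StateSpace A) : Prop :=
  ∀ a : A, τ (star a * a) = 0 → a = 0

end StateSpace

/-- The Monge-Kantorovich distance on states given by a seminorm `L` on the self-adjoint part.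
Here `L` takes values in `[0, ∞]`, and its domain consists of the self-adjoint `a` with
`L a < ∞`; the values of `L` at other elements are never used. -/
def mongeKantorovich {A : Type u} [CStarAlgebra A] (L : A → ℝ≥0∞) (φ ψ : StateSpace A) : ℝ≥0∞ :=
  ⨆ (a : A) (_ : IsSelfAdjoint a) (_ : L a ≤ 1), ‖φ a - ψ a‖ₑ

/-- The diameter of a set `S` for a distance function `d`. -/
def diameter {S : Type u} (d : S → S → ℝ≥0∞) : ℝ≥0∞ := ⨆ (s : S) (t : S), d s t

/-- The `1`-metric on a Cartesian product. -/
def oneMetric {S : Type u} {T : Type v} (d : S → S → ℝ≥0∞) (e : T → T → ℝ≥0∞) :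
    S × T → S × T → ℝ≥0∞ := fun p q => d p.1 q.1 + e p.2 q.2

/-! ## Conditional expectations and Lip-norms -/

section LipNorms

variable {A : Type v} [CStarAlgebra A]

/-- `E` is a `τ`-preserving conditional expectation of `A` onto the C*-subalgebra `B`: a contractive
linear projection of `A` onto `B` which is a `B`-bimodule map and satisfies `τ ∘ E = τ`. -/
structure IsCondExp (τ : StateSpace A) (B : StarSubalgebra ℂ A) (E : A →L[ℂ] A) : Prop where
  mem : ∀ a, E a ∈ B
  proj : ∀ b ∈ B, E b = b
  contractive : ∀ a, ‖E a‖ ≤ ‖a‖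
  bimodule : ∀ b ∈ B, ∀ c ∈ B, ∀ a, E (b * a * c) = b * E a * c
  preserving : ∀ a, τ (E a) = τ a

/-- When `τ` is faithful there is at most one `τ`-preserving conditional expectation onto `B`. -/
theorem IsCondExp.unique {τ : StateSpace A} (hτ : τ.IsFaithful) {B : StarSubalgebra ℂ A}
    {E F : A →L[ℂ] A} (hE : IsCondExp τ B E) (hF : IsCondExp τ B F) : E = F := by
  ext a
  rw [← sub_eq_zero]
  apply hτ
  have hd : star (E a - F a) ∈ B := star_mem (sub_mem (hE.mem a) (hF.mem a))
  have h1 := hE.bimodule _ hd 1 (one_mem B) a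
  have h2 := hF.bimodule _ hd 1 (one_mem B) a
  simp only [mul_one] at h1 h2
  have h3 := hE.preserving (star (E a - F a) * a)
  have h4 := hF.preserving (star (E a - F a) * a)
  rw [h1] at h3
  rw [h2] at h4
  rw [mul_sub]
  exact (map_sub τ.toLinearMap _ _).trans (by rw [h3, h4, sub_self])

open Classical in
/-- The `τ`-preserving conditional expectation of `A` onto `B`, regarded as a map from `A` to `A`.
It exists whenever `τ` is a faithful tracial state and `B` is a finite-dimensional unital
C*-subalgebra. -/
def condExp (τ : StateSpace A) (B : StarSubalgebra ℂ A) : A →L[ℂ] A :=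
  if h : ∃ E, IsCondExp τ B E then h.choose else 0

open Classical in
/-- The seminorm `L^β` on the self-adjoint part of the union of the subalgebras `𝒜 n`:
`L^β a = sup_n ‖a - E_n a‖ / β n`; it is infinite off its domain. -/
def afLip (τ : StateSpace A) (𝒜 : ℕ → StarSubalgebra ℂ A) (β : ℕ → ℝ) (a : A) : ℝ≥0∞ :=
  if ∃ n, a ∈ 𝒜 n then ⨆ n, ‖a - condExp τ (𝒜 n) a‖ₑ / ENNReal.ofReal (β n) else ⊤

variable {X : Type u} [MetricSpace X] [CompactSpace X]

/-- The Lipschitz seminorm `l f = sup_{x, y} ‖f x - f y‖ / d x y` of `f : C(X, A)`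
(where `0 / 0 = 0`). -/
def lipConst (f : C(X, A)) : ℝ≥0∞ := ⨆ (x : X) (y : X), ‖f x - f y‖ₑ / edist x y

/-- The map `C(X, A) → C(X, A)`, `f ↦ E ∘ f`, where `E` is the `τ`-preserving conditional
expectation onto `B`. -/
def condExpX (τ : StateSpace A) (B : StarSubalgebra ℂ A) (f : C(X, A)) : C(X, A) :=
  ⟨fun x => condExp τ B (f x), (condExp τ B).continuous.comp f.continuous⟩

/-- The seminorm `f ↦ l f + sup_n ‖f - E_n ∘ f‖ / β n` on `C(X, A)`, with the supremum norm. -/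
def ahLip (τ : StateSpace A) (𝒜 : ℕ → StarSubalgebra ℂ A) (β : ℕ → ℝ) (f : C(X, A)) : ℝ≥0∞ :=
  lipConst f + ⨆ n, ‖f - condExpX τ (𝒜 n) f‖ₑ / ENNReal.ofReal (β n)

end LipNorms

section TensorLip

variable (X : Type u) [MetricSpace X] [CompactSpace X] (A : Type v) [CStarAlgebra A]

/-- The *-homomorphism from the algebraic tensor product of `C(X)` and `A` to `C(X, A)` that sends
`f ⊗ a` to `x ↦ f x • a`. -/
def algTensorMap : C(X, ℂ) ⊗[ℂ] A →⋆ₐ[ℂ] C(X, A) :=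
  let iX : C(X, ℂ) →ₐ[ℂ] C(X, A) :=
    { toFun := fun f => ⟨fun x => algebraMap ℂ A (f x),
        (continuous_algebraMap ℂ A).comp f.continuous⟩
      map_one' := by ext x; simp
      map_mul' := fun f g => by ext x; simp
      map_zero' := by ext x; simp
      map_add' := fun f g => by ext x; simp
      commutes' := fun c => by ext x; simp [Algebra.algebraMap_eq_smul_one] }
  let iA : A →ₐ[ℂ] C(X, A) :=
    { toFun := fun a => ContinuousMap.const X a
      map_one' := rfl
      map_mul' := fun _ _ => rfl
      map_zero' := rfl
      map_add' := fun _ _ => rfl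
      commutes' := fun _ => rfl }
  let φ : C(X, ℂ) ⊗[ℂ] A →ₐ[ℂ] C(X, A) :=
    Algebra.TensorProduct.lift iX iA fun f a => by
      ext x
      exact Algebra.commutes (f x) a
  { φ with
    map_star' := fun t => by
      change φ (star t) = star (φ t)
      induction t with
      | zero => simp
      | tmul f a =>
        ext x
        change algebraMap ℂ A (star f x) * star a = star (algebraMap ℂ A (f x) * a)
        rw [star_mul, ← algebraMap_star_comm, ← Algebra.commutes]
        rfl
      | add s t hs ht => rw [star_add, map_add, hs, ht, map_add, star_add] }

theorem algTensorMap_tmul (f : C(X, ℂ)) (a : A) (x : X) :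
    algTensorMap X A (f ⊗ₜ[ℂ] a) x = f x • a := by
  change algebraMap ℂ A (f x) * a = f x • a
  rw [Algebra.smul_def]

theorem norm_algTensorMap_le (t : C(X, ℂ) ⊗[ℂ] A) :
    ‖algTensorMap X A t‖ ≤ maxCStarSeminorm C(X, ℂ) A t :=
  le_ciSup (CStarSeminorm.bddAbove_tensor t)
    ((CStarSeminorm.ofNorm C(X, A)).comap (algTensorMap X A))

/-- The canonical *-isomorphism from the C*-algebraic tensor product of `C(X)` and `A` to
`C(X, A)`: the *-homomorphism determined by `(f ⊗ a) ↦ (x ↦ f x • a)`. -/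
def tensorMap : CStarTensor C(X, ℂ) A →⋆ₐ[ℂ] C(X, A) :=
  CStarSeminorm.Completion.lift (algTensorMap X A) (norm_algTensorMap_le X A)

variable {X A}

/-- The seminorm on the tensor product of `C(X)` and `A` obtained from the one on `C(X, A)`. -/
def tensorLip (τ : StateSpace A) (𝒜 : ℕ → StarSubalgebra ℂ A) (β : ℕ → ℝ)
    (t : CStarTensor C(X, ℂ) A) : ℝ≥0∞ := ahLip τ 𝒜 β (tensorMap X A t)

end TensorLip

end

noncomputable section

/-! ## States -/

/-! Let `D` be the diameter of `X` plus that of the state space of `A`. Both diameter bounds follow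
once each self-adjoint `f` in the unit ball of the seminorm lies within `D / 2` of a real scalar:
states agree on scalars, so two states differ at `f` by at most `D`
(`diameter_mongeKantorovich_le`). To find the scalar, pass from `θ (f x)` to `θ (f y)` at a cost of
at most `d(x, y)`, then from `θ (f y)` to `η (f y)` at a cost of at most the diameter of the state
space of `A`. All the numbers `θ (f x)` thus lie in one interval of length `D`, and its midpoint is
the scalar (`exists_norm_sub_algebraMap_le`). The states of `A` control norms here because a
faithful `τ` already has enough vector states.

Two points need work. The value `f y` need not lie in the union of the `𝒜 n`, so it is replaced by
its conditional expectations, which do not increase the seminorm and converge since `β` tends to `0`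
(`enorm_sub_le_mongeKantorovich_afLip`). For the tensor product, the canonical map must be
isometric: a quadratic partition of unity shows that every C*-seminorm on the algebraic tensor
product is at most the supremum norm (`CStarSeminorm.le_norm_algTensorMap`).

The isometry statement is attained at the scalar-valued function `d(x, ·) 1`, which every
conditional expectation fixes. -/

theorem CStarAlgebra.norm_le_of_mem_Icc {A : Type v} [CStarAlgebra A] [PartialOrder A]
    [StarOrderedRing A] {a : A} (ha : IsSelfAdjoint a) {r : ℝ} (hr : 0 ≤ r)
    (h : a ∈ Set.Icc (-algebraMap ℝ A r) (algebraMap ℝ A r)) : ‖a‖ ≤ r := by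
  rcases subsingleton_or_nontrivial A with _ | _
  · rwa [Subsingleton.elim a 0, norm_zero]
  obtain ⟨h1, h2⟩ := h
  rw [← map_neg, algebraMap_le_iff_le_spectrum] at h1
  rw [le_algebraMap_iff_spectrum_le] at h2
  rcases CStarAlgebra.norm_or_neg_norm_mem_spectrum ha with h | h
  · exact h2 _ h
  · exact neg_le_neg_iff.mp (h1 _ h)

namespace StateSpace

section Basic

variable {A : Type v} [CStarAlgebra A]

theorem map_one (φ : StateSpace A) : φ 1 = 1 := φ.map_one'

theorem map_algebraMap (φ : StateSpace A) (c : ℂ) : φ (algebraMap ℂ A c) = c := by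
  rw [Algebra.algebraMap_eq_smul_one, map_smul, φ.map_one, smul_eq_mul, mul_one]

theorem map_algebraMap_real (φ : StateSpace A) (c : ℝ) : φ (algebraMap ℝ A c) = c := by
  rw [IsScalarTower.algebraMap_apply ℝ ℂ A, φ.map_algebraMap]
  rfl

theorem map_nonneg [PartialOrder A] [StarOrderedRing A] (φ : StateSpace A) {a : A} (ha : 0 ≤ a) :
    0 ≤ φ a := by
  obtain ⟨b, rfl⟩ := CStarAlgebra.nonneg_iff_eq_star_mul_self.mp ha
  exact φ.nonneg' b

theorem mono [PartialOrder A] [StarOrderedRing A] (φ : StateSpace A) {a b : A} (hab : a ≤ b) :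
    φ a ≤ φ b := by
  have := φ.map_nonneg (sub_nonneg.mpr hab)
  rwa [map_sub, sub_nonneg] at this

theorem apply_mem_Icc (φ : StateSpace A) {a : A} (ha : IsSelfAdjoint a) :
    φ a ∈ Set.Icc (-(‖a‖ : ℂ)) ‖a‖ := by
  let _ := CStarAlgebra.spectralOrder A
  have := CStarAlgebra.spectralOrderedRing A
  have h1 := φ.mono ha.le_algebraMap_norm_self
  have h2 := φ.mono ha.neg_algebraMap_norm_le_self
  rw [map_neg, φ.map_algebraMap_real] at h2
  rw [φ.map_algebraMap_real] at h1
  exact ⟨h2, h1⟩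

theorem apply_eq_re (φ : StateSpace A) {a : A} (ha : IsSelfAdjoint a) : φ a = ((φ a).re : ℂ) := by
  have h := (Complex.le_def.mp (φ.apply_mem_Icc ha).2).2
  apply Complex.ext <;> simp_all

theorem norm_apply_le (φ : StateSpace A) {a : A} (ha : IsSelfAdjoint a) : ‖φ a‖ ≤ ‖a‖ := by
  obtain ⟨h1, h2⟩ := φ.apply_mem_Icc ha
  rw [φ.apply_eq_re ha] at h1 h2 ⊢
  rw [Complex.norm_real, Real.norm_eq_abs, abs_le]
  exact ⟨by exact_mod_cast h1, by exact_mod_cast h2⟩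

theorem map_star (φ : StateSpace A) (a : A) : φ (star a) = star (φ a) := by
  have h1 : star a = (realPart a : A) - Complex.I • (imaginaryPart a : A) := by
    conv_lhs => rw [← realPart_add_I_smul_imaginaryPart a]
    simp [sub_eq_add_neg]
  have h2 : φ a = φ (realPart a : A) + Complex.I * φ (imaginaryPart a : A) := by
    conv_lhs => rw [← realPart_add_I_smul_imaginaryPart a]
    rw [map_add, map_smul, smul_eq_mul]
  rw [h1, h2, map_sub, map_smul, φ.apply_eq_re (realPart a).2, φ.apply_eq_re (imaginaryPart a).2]
  simp [sub_eq_add_neg]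

theorem norm_sub_le_of_norm_sub_algebraMap_le (φ ψ : StateSpace A) {a : A} (ha : IsSelfAdjoint a)
    {c : ℂ} (hc : IsSelfAdjoint c) {r : ℝ} (h : ‖a - algebraMap ℂ A c‖ ≤ r) :
    ‖φ a - ψ a‖ ≤ 2 * r := by
  have hs : IsSelfAdjoint (a - algebraMap ℂ A c) := ha.sub (hc.algebraMap A)
  have h1 := (φ.norm_apply_le hs).trans h
  have h2 := (ψ.norm_apply_le hs).trans h
  rw [map_sub, map_algebraMap] at h1 h2
  calc ‖φ a - ψ a‖ = ‖(φ a - c) - (ψ a - c)‖ := by rw [sub_sub_sub_cancel_right]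
    _ ≤ ‖φ a - c‖ + ‖ψ a - c‖ := norm_sub_le _ _
    _ ≤ 2 * r := by linarith

/-- The vector state `a ↦ τ (b* a b) / τ (b* b)`. -/
def vector (τ : StateSpace A) (b : A) (hb : τ (star b * b) ≠ 0) : StateSpace A where
  toLinearMap := (τ (star b * b))⁻¹ • (τ.toLinearMap ∘ₗ LinearMap.mulLeftRight ℂ (star b, b))
  map_one' := by simp [hb]
  nonneg' a := by
    have h : (τ.toLinearMap ∘ₗ LinearMap.mulLeftRight ℂ (star b, b)) (star a * a) =
        τ (star (a * b) * (a * b)) := by simp [mul_assoc]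
    rw [LinearMap.smul_apply, h, smul_eq_mul]
    exact mul_nonneg (inv_nonneg.mpr (τ.nonneg' b)) (τ.nonneg' _)

theorem vector_apply (τ : StateSpace A) (b : A) (hb : τ (star b * b) ≠ 0) (a : A) :
    τ.vector b hb a = (τ (star b * b))⁻¹ * τ (star b * a * b) := by
  change (τ (star b * b))⁻¹ • τ (LinearMap.mulLeftRight ℂ (star b, b) a) = _
  simp

section Order

variable [PartialOrder A] [StarOrderedRing A]

/-- Test with `b = h⁻`, which belongs to `B` by functional calculus: since `h⁻ h h⁻ = -(h⁻)³`, the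
value of `τ` at `(h⁻)³` is at most `0`, and faithfulness gives `h⁻ = 0`. The case `B = ⊤` recovers
the order of `A` from states; general `B` serves for the contractivity of expectations. -/
theorem IsFaithful.nonneg_of_forall_mem {τ : StateSpace A} (hτ : τ.IsFaithful)
    {B : StarSubalgebra ℂ A} (hB : IsClosed (B : Set A)) {h : A} (hsa : IsSelfAdjoint h)
    (hB' : h ∈ B) (H : ∀ b ∈ B, 0 ≤ τ (star b * h * b)) : 0 ≤ h := by
  have hmem : h⁻ ∈ B := by
    rw [CFC.negPart_def]
    exact cfcₙ_mem (hs := hB) _ hB'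
  have hn : 0 ≤ h⁻ := CFC.negPart_nonneg h
  have hns : star (h⁻) = h⁻ := (IsSelfAdjoint.of_nonneg hn).star_eq
  have hmul : star (h⁻) * h * h⁻ = -(h⁻ * h⁻ * h⁻) := by
    have hh : h * h⁻ = -(h⁻ * h⁻) := by
      conv_lhs => enter [1]; rw [← CFC.posPart_sub_negPart h hsa]
      rw [sub_mul, CFC.posPart_mul_negPart, zero_sub]
    rw [hns, mul_assoc, hh, mul_neg, mul_assoc]
  have h1 := H _ hmem
  rw [hmul, map_neg, neg_nonneg] at h1
  -- Faithfulness speaks only of elements `star c * c`; a factorisation of `h⁻` puts the cube in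
  -- that form.
  obtain ⟨s, hs⟩ := CStarAlgebra.nonneg_iff_eq_star_mul_self.mp hn
  have h2 : h⁻ * h⁻ * h⁻ = star (s * h⁻) * (s * h⁻) := by
    rw [star_mul, hns]
    conv_lhs => enter [1, 2]; rw [hs]
    simp only [mul_assoc]
  rw [h2] at h1
  have h3 : s * h⁻ = 0 := hτ _ (le_antisymm h1 (τ.nonneg' _))
  have h4 : h⁻ = 0 := by
    have : star (h⁻) * h⁻ = 0 := by
      rw [hns]
      conv_lhs => enter [1]; rw [hs]
      rw [mul_assoc, h3, mul_zero]
    exact CStarRing.star_mul_self_eq_zero_iff _ |>.mp this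
  exact (CFC.negPart_eq_zero_iff h hsa).mp h4

/-- The vector states of `τ` suffice, so no extension of functionals is needed. Where a vector state
is undefined, faithfulness makes the vector `b` zero. -/
theorem IsFaithful.le_algebraMap {τ : StateSpace A} (hτ : τ.IsFaithful) {a : A}
    (ha : IsSelfAdjoint a) {K : ℝ} (H : ∀ θ : StateSpace A, (θ a).re ≤ K) :
    a ≤ algebraMap ℝ A K := by
  rw [← sub_nonneg]
  refine hτ.nonneg_of_forall_mem (B := ⊤) isClosed_univ
    ((IsSelfAdjoint.algebraMap A (.all K)).sub ha) trivial fun b _ => ?_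
  by_cases hb : τ (star b * b) = 0
  · rw [hτ b hb, mul_zero, map_zero]
  have h1 := H (τ.vector b hb)
  have h2 : 0 ≤ τ.vector b hb (algebraMap ℝ A K - a) := by
    rw [map_sub, map_algebraMap_real, apply_eq_re _ ha, sub_nonneg]
    exact_mod_cast h1
  rw [vector_apply] at h2
  have h3 := mul_nonneg (τ.nonneg' b) h2
  rwa [mul_inv_cancel_left₀ hb] at h3

end Order

/-- If the values of all states at a self-adjoint element lie within `r` of `c`, then this element
is within `r` of `c`. -/
theorem IsFaithful.norm_sub_algebraMap_le {τ : StateSpace A} (hτ : τ.IsFaithful) {a : A}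
    (ha : IsSelfAdjoint a) {c r : ℝ} (hr : 0 ≤ r)
    (H : ∀ θ : StateSpace A, (θ a).re ∈ Set.Icc (c - r) (c + r)) :
    ‖a - algebraMap ℂ A c‖ ≤ r := by
  let _ := CStarAlgebra.spectralOrder A
  have := CStarAlgebra.spectralOrderedRing A
  have hc : algebraMap ℂ A c = algebraMap ℝ A c :=
    (IsScalarTower.algebraMap_apply ℝ ℂ A c).symm
  rw [hc]
  have h1 : a ≤ algebraMap ℝ A (c + r) := hτ.le_algebraMap ha fun θ => (H θ).2
  have h2 : -a ≤ algebraMap ℝ A (-(c - r)) := hτ.le_algebraMap ha.neg fun θ => by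
    rw [map_neg, Complex.neg_re]
    exact neg_le_neg (H θ).1
  have hs : IsSelfAdjoint (a - algebraMap ℝ A c) := ha.sub (.algebraMap A (.all c))
  exact CStarAlgebra.norm_le_of_mem_Icc hs hr ⟨by
    rw [_root_.map_neg, map_sub] at h2
    rw [← sub_nonneg] at h2 ⊢
    convert h2 using 1
    abel, by
    rw [map_add] at h1
    rw [sub_le_iff_le_add, add_comm]
    exact h1⟩

end Basic

end StateSpace

/-! ## Existence and properties of conditional expectations -/

section CondExp

variable {A : Type v} [CStarAlgebra A] {τ : StateSpace A}

theorem StarSubalgebra.isClosed_of_finiteDimensional (B : StarSubalgebra ℂ A)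
    [FiniteDimensional ℂ B] : IsClosed (B : Set A) :=
  have : FiniteDimensional ℂ (Subalgebra.toSubmodule B.toSubalgebra) :=
    inferInstanceAs (FiniteDimensional ℂ B)
  Submodule.closed_of_finiteDimensional (Subalgebra.toSubmodule B.toSubalgebra)

/-- Elements of a subalgebra with the same pairings against the subalgebra are equal. -/
theorem StateSpace.IsFaithful.eq_of_forall_mem (hτ : τ.IsFaithful) {B : StarSubalgebra ℂ A}
    {x y : A} (hx : x ∈ B) (hy : y ∈ B) (h : ∀ b ∈ B, τ (b * x) = τ (b * y)) : x = y := by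
  rw [← sub_eq_zero]
  apply hτ
  rw [mul_sub, map_sub, h _ (star_mem (sub_mem hx hy)), sub_self]

/-- The orthogonal projection onto a finite-dimensional subalgebra, for a faithful state. -/
theorem StateSpace.IsFaithful.exists_orthogonalProjection (hτ : τ.IsFaithful)
    (B : StarSubalgebra ℂ A) [FiniteDimensional ℂ B] :
    ∃ E : A →ₗ[ℂ] A, (∀ a, E a ∈ B) ∧ ∀ a, ∀ b ∈ B, τ (b * E a) = τ (b * a) := by
  let ι : B →ₗ[ℂ] A := B.subtype.toAlgHom.toLinearMap
  let T : A →ₗ[ℂ] Module.Dual ℂ B :=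
    LinearMap.flip ((LinearMap.compr₂ (LinearMap.mul ℂ A) τ.toLinearMap) ∘ₗ ι)
  have hT : ∀ a (b : B), T a b = τ (b * a) := fun a b => rfl
  have hinj : Function.Injective (T ∘ₗ ι) := fun x y hxy =>
    Subtype.ext <| hτ.eq_of_forall_mem x.2 y.2 fun b hb => by
      have := DFunLike.congr_fun hxy ⟨b, hb⟩
      exact this
  -- The pairing `τ (b * x)` is nondegenerate on `B`, so by equality of dimensions every functional
  -- on `B` is represented by a unique element.
  let e : B ≃ₗ[ℂ] Module.Dual ℂ B :=
    LinearEquiv.ofInjectiveOfFinrankEq (T ∘ₗ ι) hinj Subspace.dual_finrank_eq.symm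
  refine ⟨ι ∘ₗ e.symm.toLinearMap ∘ₗ T, fun a => (e.symm (T a)).2, fun a b hb => ?_⟩
  have h1 : (T ∘ₗ ι) (e.symm (T a)) = T a := e.apply_symm_apply (T a)
  exact DFunLike.congr_fun h1 ⟨b, hb⟩

/-- The orthogonal projection onto a closed subalgebra, for a faithful tracial state, is
contractive in norm. -/
theorem StateSpace.IsFaithful.norm_le_of_forall_mem (hτ : τ.IsFaithful) (htr : τ.IsTracial)
    {B : StarSubalgebra ℂ A} (hB : IsClosed (B : Set A)) {a x : A} (hx : x ∈ B)
    (h : ∀ b ∈ B, τ (b * x) = τ (b * a)) : ‖x‖ ≤ ‖a‖ := by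
  let _ := CStarAlgebra.spectralOrder A
  have := CStarAlgebra.spectralOrderedRing A
  have hsa : IsSelfAdjoint (algebraMap ℝ A (‖a‖ ^ 2) - star x * x) :=
    (IsSelfAdjoint.algebraMap A (.all _)).sub (.star_mul_self x)
  have hmem : algebraMap ℝ A (‖a‖ ^ 2) - star x * x ∈ B := by
    rw [IsScalarTower.algebraMap_apply ℝ ℂ A]
    exact sub_mem (algebraMap_mem B _) (mul_mem (star_mem hx) hx)
  have key : 0 ≤ algebraMap ℝ A (‖a‖ ^ 2) - star x * x := by
    refine hτ.nonneg_of_forall_mem hB hsa hmem fun b hb => ?_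
    -- Traciality brings the last `b` to the front, where `b b* x*` lies in `B` and `h` applies.
    -- Both cross terms of `τ (|(a - x) b|²)` then equal the `x* x` term, so positivity gives `τ (b*
    -- x* x b) ≤ τ (b* a* a b)`.
    have e1 : τ (star b * (star x * a) * b) = τ (star b * (star x * x) * b) := by
      rw [htr (star b * (star x * a)) b, htr (star b * (star x * x)) b]
      have := h (b * star b * star x) (mul_mem (mul_mem hb (star_mem hb)) (star_mem hx))
      simpa only [mul_assoc] using this.symm
    have e2 : τ (star b * (star a * x) * b) = τ (star b * (star x * x) * b) := by
      have h1 : star b * (star a * x) * b = star (star b * (star x * a) * b) := by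
        simp [mul_assoc]
      have h2 : star b * (star x * x) * b = star (star b * (star x * x) * b) := by
        simp [mul_assoc]
      rw [h1, τ.map_star, e1, ← τ.map_star, ← h2]
    have h3 := τ.nonneg' ((a - x) * b)
    have e3 : star ((a - x) * b) * ((a - x) * b) = star b * (star a * a) * b
        - star b * (star a * x) * b - star b * (star x * a) * b + star b * (star x * x) * b := by
      rw [star_mul, star_sub]; noncomm_ring
    rw [e3, map_add, map_sub, map_sub, e1, e2, sub_add_cancel] at h3
    have h4 : 0 ≤ τ (star b * (algebraMap ℝ A (‖a‖ ^ 2) - star a * a) * b) :=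
      τ.map_nonneg (star_left_conjugate_nonneg
        (sub_nonneg.mpr CStarAlgebra.star_mul_le_algebraMap_norm_sq) b)
    rw [mul_sub, sub_mul, map_sub] at h4 ⊢
    convert add_nonneg h3 h4 using 1
    ring
  rw [sub_nonneg] at key
  have h5 := (CStarAlgebra.norm_le_iff_le_algebraMap (star x * x) (by positivity)).mpr key
  rw [CStarRing.norm_star_mul_self, ← sq] at h5
  exact (sq_le_sq₀ (norm_nonneg _) (norm_nonneg _)).mp h5

/-- The orthogonal projection works. The algebraic identities are checked by pairing with `B`; for
the bimodule property, traciality turns the pairing of `d` with `b y c` into that of `c d b` with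
`y`. -/
theorem exists_isCondExp (hτ : τ.IsFaithful) (htr : τ.IsTracial) (B : StarSubalgebra ℂ A)
    [FiniteDimensional ℂ B] : ∃ E, IsCondExp τ B E := by
  obtain ⟨E, hE, hEτ⟩ := hτ.exists_orthogonalProjection B
  have hle : ∀ a, ‖E a‖ ≤ ‖a‖ := fun a =>
    hτ.norm_le_of_forall_mem htr B.isClosed_of_finiteDimensional (hE a) (hEτ a)
  refine ⟨E.mkContinuous 1 fun a => by simpa using hle a, hE, fun b hb => ?_, hle,
    fun b hb c hc a => ?_, fun a => ?_⟩
  · exact hτ.eq_of_forall_mem (hE b) hb (hEτ b)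
  · refine hτ.eq_of_forall_mem (hE _) (mul_mem (mul_mem hb (hE a)) hc) fun d hd => ?_
    rw [LinearMap.mkContinuous_apply, hEτ _ d hd]
    have h1 := hEτ a (c * (d * b)) (mul_mem hc (mul_mem hd hb))
    have e : ∀ y, τ (d * (b * y * c)) = τ (c * (d * b) * y) := fun y => by
      rw [mul_assoc c, htr c]; simp only [mul_assoc]
    rw [e, e]
    exact h1.symm
  · simpa using hEτ a 1 (one_mem B)

theorem isCondExp_condExp (hτ : τ.IsFaithful) (htr : τ.IsTracial) (B : StarSubalgebra ℂ A)
    [FiniteDimensional ℂ B] : IsCondExp τ B (condExp τ B) := by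
  have h := exists_isCondExp hτ htr B
  rw [condExp, dif_pos h]
  exact h.choose_spec

namespace IsCondExp

variable {B C : StarSubalgebra ℂ A} {E F : A →L[ℂ] A}

theorem apply_mul (hE : IsCondExp τ B E) (a : A) {b : A} (hb : b ∈ B) :
    τ (b * E a) = τ (b * a) := by
  have h := hE.bimodule b hb 1 (one_mem B) a
  rw [mul_one, mul_one] at h
  rw [← h, hE.preserving]

theorem map_star (hE : IsCondExp τ B E) (hτ : τ.IsFaithful) (htr : τ.IsTracial) (a : A) :
    E (star a) = star (E a) := by
  refine hτ.eq_of_forall_mem (hE.mem _) (star_mem (hE.mem a)) fun b hb => ?_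
  rw [hE.apply_mul _ hb, htr b, htr b]
  have e : ∀ y : A, τ (star y * b) = star (τ (star b * y)) := fun y => by
    rw [← τ.map_star, star_mul, star_star]
  rw [e, e, hE.apply_mul a (star_mem hb)]

theorem isSelfAdjoint_apply (hE : IsCondExp τ B E) (hτ : τ.IsFaithful) (htr : τ.IsTracial)
    {a : A} (ha : IsSelfAdjoint a) : IsSelfAdjoint (E a) := by
  rw [IsSelfAdjoint, ← hE.map_star hτ htr, ha.star_eq]

/-- The tower property. -/
theorem apply_apply_of_le (hE : IsCondExp τ B E) (hF : IsCondExp τ C F) (hτ : τ.IsFaithful)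
    (hBC : B ≤ C) (a : A) : E (F a) = E a := by
  refine hτ.eq_of_forall_mem (hE.mem _) (hE.mem _) fun b hb => ?_
  rw [hE.apply_mul _ hb, hE.apply_mul _ hb, hF.apply_mul _ (hBC hb)]

end IsCondExp

end CondExp

/-! ## The Lip-norm of an inductive sequence -/

section AFLip

variable {A : Type v} [CStarAlgebra A] {τ : StateSpace A} {𝒜 : ℕ → StarSubalgebra ℂ A} {β : ℕ → ℝ}

theorem norm_le_of_enorm_div_le_one {E : Type*} [SeminormedAddGroup E] {x : E} {b : ℝ} (hb : 0 < b)
    (h : ‖x‖ₑ / ENNReal.ofReal b ≤ 1) : ‖x‖ ≤ b := by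
  rw [ENNReal.div_le_iff (ENNReal.ofReal_pos.mpr hb).ne' ENNReal.ofReal_ne_top, one_mul,
    ← ofReal_norm] at h
  exact (ENNReal.ofReal_le_ofReal_iff hb.le).mp h

theorem enorm_le_ofReal {E : Type*} [SeminormedAddGroup E] {x : E} {b : ℝ} (h : ‖x‖ ≤ b) :
    ‖x‖ₑ ≤ ENNReal.ofReal b := by
  rw [← ofReal_norm]
  exact ENNReal.ofReal_le_ofReal h

theorem le_mongeKantorovich {L : A → ℝ≥0∞} {a : A} (ha : IsSelfAdjoint a) (h : L a ≤ 1)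
    (φ ψ : StateSpace A) : ‖φ a - ψ a‖ₑ ≤ mongeKantorovich L φ ψ :=
  le_iSup_of_le a (le_iSup₂_of_le ha h le_rfl)

theorem mongeKantorovich_le {L : A → ℝ≥0∞} {φ ψ : StateSpace A} {C : ℝ≥0∞}
    (h : ∀ a, IsSelfAdjoint a → L a ≤ 1 → ‖φ a - ψ a‖ₑ ≤ C) : mongeKantorovich L φ ψ ≤ C :=
  iSup_le fun a => iSup₂_le (h a)

/-- If all elements of the unit ball of `L` are within `r` of a real scalar, then the diameter of
the state space is at most `2 * r`. -/
theorem diameter_mongeKantorovich_le {L : A → ℝ≥0∞} {r : ℝ}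
    (h : ∀ a, IsSelfAdjoint a → L a ≤ 1 →
      ∃ c : ℂ, IsSelfAdjoint c ∧ ‖a - algebraMap ℂ A c‖ ≤ r) :
    diameter (mongeKantorovich L) ≤ ENNReal.ofReal (2 * r) :=
  iSup₂_le fun φ ψ => mongeKantorovich_le fun a ha hL => by
    obtain ⟨c, hc, hr⟩ := h a ha hL
    exact enorm_le_ofReal (φ.norm_sub_le_of_norm_sub_algebraMap_le ψ ha hc hr)

theorem le_diameter {S : Type u} (d : S → S → ℝ≥0∞) (s t : S) : d s t ≤ diameter d :=
  le_iSup₂ (f := d) s t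

/-- The two suprema are independent. An empty factor would make the diameter of the product zero,
hence the nonemptiness. -/
theorem diameter_oneMetric {S : Type u} {T : Type v} [Nonempty S] [Nonempty T]
    (d : S → S → ℝ≥0∞) (e : T → T → ℝ≥0∞) :
    diameter (oneMetric d e) = diameter d + diameter e := by
  refine le_antisymm
    (iSup₂_le fun p q => add_le_add (le_diameter d p.1 q.1) (le_diameter e p.2 q.2)) ?_
  simp only [diameter, ENNReal.iSup_add, ENNReal.add_iSup]
  exact iSup_le fun s => iSup_le fun t => iSup_le fun s' => iSup_le fun t' =>
    le_diameter (oneMetric d e) (_, _) (_, _)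

/-- Truncating by `E_m` moves any element into the domain of the seminorm. The terms with `n ≥ m`
vanish; for `n ≤ m` the tower property gives `E_m a - E_n (E_m a) = E_m (a - E_n a)`, and `E_m` is
contractive. -/
theorem afLip_condExp_le (hτ : τ.IsFaithful) (htr : τ.IsTracial) (hmono : Monotone 𝒜)
    [∀ n, FiniteDimensional ℂ (𝒜 n)] (a : A) (m : ℕ) :
    afLip τ 𝒜 β (condExp τ (𝒜 m) a) ≤
      ⨆ n, ‖a - condExp τ (𝒜 n) a‖ₑ / ENNReal.ofReal (β n) := by
  have hE := fun n => isCondExp_condExp hτ htr (𝒜 n)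
  rw [afLip, if_pos ⟨m, (hE m).mem a⟩]
  refine iSup_mono fun n => ENNReal.div_le_div_right ?_ _
  rcases le_total m n with h | h
  · rw [(hE n).proj _ (hmono h ((hE m).mem a)), sub_self, enorm_zero]
    exact zero_le
  · have e : condExp τ (𝒜 m) a - condExp τ (𝒜 n) (condExp τ (𝒜 m) a) =
        condExp τ (𝒜 m) (a - condExp τ (𝒜 n) a) := by
      rw [map_sub, (hE m).proj _ (hmono h ((hE n).mem a)),
        (hE n).apply_apply_of_le (hE m) hτ (hmono h)]
    rw [e]
    exact enorm_le_iff_norm_le.mpr ((hE m).contractive _)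

/-- Off the union of the `𝒜 n`, `afLip` is infinite and `a` itself cannot serve as a test element.
The truncations `E_n a` can, and `‖a - E_n a‖ ≤ β n` lets the inequality pass to the limit. -/
theorem enorm_sub_le_mongeKantorovich_afLip (hτ : τ.IsFaithful) (htr : τ.IsTracial)
    (hmono : Monotone 𝒜) [∀ n, FiniteDimensional ℂ (𝒜 n)] (hβ : ∀ n, 0 < β n)
    (hlim : Filter.Tendsto β Filter.atTop (𝓝 0)) {a : A} (ha : IsSelfAdjoint a)
    (h : ⨆ n, ‖a - condExp τ (𝒜 n) a‖ₑ / ENNReal.ofReal (β n) ≤ 1) (φ ψ : StateSpace A) :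
    ‖φ a - ψ a‖ₑ ≤ mongeKantorovich (afLip τ 𝒜 β) φ ψ := by
  have hE := fun n => isCondExp_condExp hτ htr (𝒜 n)
  have hsa := fun n => (hE n).isSelfAdjoint_apply hτ htr ha
  have key : ∀ θ : StateSpace A,
      Filter.Tendsto (fun n => θ (condExp τ (𝒜 n) a)) Filter.atTop (𝓝 (θ a)) := fun θ => by
    rw [tendsto_iff_norm_sub_tendsto_zero]
    refine squeeze_zero (fun _ => norm_nonneg _) (fun n => ?_) hlim
    rw [norm_sub_rev, ← map_sub]
    exact (θ.norm_apply_le (ha.sub (hsa n))).trans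
      (norm_le_of_enorm_div_le_one (hβ n) ((le_iSup _ n).trans h))
  exact le_of_tendsto (((key φ).sub (key ψ)).enorm) (Filter.Eventually.of_forall fun n =>
    le_mongeKantorovich (hsa n) ((afLip_condExp_le hτ htr hmono a n).trans h) φ ψ)

/-- Only the term `n = 0` matters: `E_0 a` is a scalar within `β 0` of `a`. -/
theorem diameter_mongeKantorovich_afLip_le (hτ : τ.IsFaithful) (htr : τ.IsTracial)
    (h0 : 𝒜 0 = ⊥) [∀ n, FiniteDimensional ℂ (𝒜 n)] (hβ : ∀ n, 0 < β n) :
    diameter (mongeKantorovich (afLip τ 𝒜 β)) ≤ ENNReal.ofReal (2 * β 0) := by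
  refine diameter_mongeKantorovich_le fun a ha hL => ?_
  have hE := isCondExp_condExp hτ htr (𝒜 0)
  have hmem := hE.mem a
  rw [h0, StarSubalgebra.mem_bot] at hmem
  obtain ⟨c, hc⟩ := hmem
  rw [← h0] at hc
  have hcsa : IsSelfAdjoint c := by
    have h1 := congrArg τ (hE.isSelfAdjoint_apply hτ htr ha).star_eq
    rwa [τ.map_star, ← hc, τ.map_algebraMap] at h1
  refine ⟨c, hcsa, ?_⟩
  rw [hc]
  rw [afLip] at hL
  split_ifs at hL with hm
  · exact norm_le_of_enorm_div_le_one (hβ 0) ((le_iSup (fun n =>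
      ‖a - condExp τ (𝒜 n) a‖ₑ / ENNReal.ofReal (β n)) 0).trans hL)
  · simp at hL

end AFLip

/-! ## Lipschitz seminorms on continuous functions -/

section Lip

variable {X : Type u} [MetricSpace X] {A : Type v} [CStarAlgebra A]

theorem enorm_sub_le_of_lipConst_le_one {f : C(X, A)} (h : lipConst f ≤ 1) (x y : X) :
    ‖f x - f y‖ₑ ≤ edist x y := by
  rcases eq_or_ne x y with rfl | hxy
  · simp
  have h1 := (le_iSup₂ (f := fun x y => ‖f x - f y‖ₑ / edist x y) x y).trans h
  rwa [ENNReal.div_le_iff (edist_pos.mpr hxy).ne' (edist_ne_top x y), one_mul] at h1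

/-- The interval starts at the infimum of `S`. The radius `D / 2` is what cancels the factor `2` in
`diameter_mongeKantorovich_le`. -/
theorem exists_forall_mem_Icc {S : Set ℝ} {D : ℝ} (h : ∀ s ∈ S, ∀ t ∈ S, s - t ≤ D) :
    ∃ c, ∀ s ∈ S, s ∈ Set.Icc (c - D / 2) (c + D / 2) := by
  refine ⟨sInf S + D / 2, fun s hs => ⟨?_, ?_⟩⟩
  · have := csInf_le ⟨s - D, fun t ht => by linarith [h s hs t ht]⟩ hs
    linarith
  · have : s - D ≤ sInf S := le_csInf ⟨s, hs⟩ fun t ht => by linarith [h s hs t ht]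
    linarith

variable [CompactSpace X]

/-- The centre `c` is chosen for all states and all points at once, so the pointwise estimates give
a bound in the supremum norm. -/
theorem exists_norm_sub_algebraMap_le {τ : StateSpace A} (hτ : τ.IsFaithful) {f : C(X, A)}
    (hf : IsSelfAdjoint f) {D : ℝ≥0∞} (hD : D ≠ ⊤)
    (H : ∀ (θ η : StateSpace A) (x y : X), ‖θ (f x) - η (f y)‖ₑ ≤ D) :
    ∃ c : ℂ, IsSelfAdjoint c ∧ ‖f - algebraMap ℂ C(X, A) c‖ ≤ D.toReal / 2 := by
  have hfx : ∀ x, IsSelfAdjoint (f x) := fun x => DFunLike.congr_fun hf x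
  obtain ⟨c, hc⟩ := exists_forall_mem_Icc (D := D.toReal)
    (S := Set.range fun p : StateSpace A × X => (p.1 (f p.2)).re) (by
      rintro _ ⟨⟨θ, x⟩, rfl⟩ _ ⟨⟨η, y⟩, rfl⟩
      rw [← Complex.sub_re]
      refine (Complex.re_le_norm _).trans ?_
      rw [← toReal_enorm]
      exact ENNReal.toReal_mono hD (H θ η x y))
  refine ⟨c, Complex.conj_ofReal c, ?_⟩
  rw [ContinuousMap.norm_le _ (by positivity)]
  exact fun x => hτ.norm_sub_algebraMap_le (hfx x) (by positivity) fun θ => hc _ ⟨(θ, x), rfl⟩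

/-! ### Distance functions and evaluations at points -/

variable (A) in
/-- The `A`-valued function `y ↦ d(x, y) 1`, as an element of the algebraic tensor product. -/
def distTensor (x : X) : C(X, ℂ) ⊗[ℂ] A :=
  (⟨fun y => (dist x y : ℂ), by fun_prop⟩ : C(X, ℂ)) ⊗ₜ[ℂ] 1

theorem algTensorMap_distTensor_apply (x y : X) :
    algTensorMap X A (distTensor A x) y = algebraMap ℂ A (dist x y : ℂ) := by
  rw [distTensor, algTensorMap_tmul, Algebra.algebraMap_eq_smul_one]
  rfl

theorem isSelfAdjoint_distTensor (x : X) : IsSelfAdjoint (distTensor A x) := by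
  rw [IsSelfAdjoint, distTensor, TensorProduct.star_tmul, star_one]
  congr 1
  ext y
  exact Complex.conj_ofReal _

theorem lipConst_distTensor_le [Nontrivial A] (x : X) :
    lipConst (algTensorMap X A (distTensor A x)) ≤ 1 :=
  iSup₂_le fun y z => ENNReal.div_le_of_le_mul <| by
    rw [algTensorMap_distTensor_apply, algTensorMap_distTensor_apply, ← map_sub, one_mul,
      edist_dist]
    refine enorm_le_ofReal ?_
    rw [norm_algebraMap', ← Complex.ofReal_sub, Complex.norm_real, Real.norm_eq_abs,
      dist_comm x y, dist_comm x z]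
    exact abs_dist_sub_le y z x

theorem ahLip_distTensor_le [Nontrivial A] {τ : StateSpace A} (hτ : τ.IsFaithful)
    (htr : τ.IsTracial) (𝒜 : ℕ → StarSubalgebra ℂ A) [∀ n, FiniteDimensional ℂ (𝒜 n)] (β : ℕ → ℝ)
    (x : X) : ahLip τ 𝒜 β (algTensorMap X A (distTensor A x)) ≤ 1 := by
  have h : ∀ n, condExpX τ (𝒜 n) (algTensorMap X A (distTensor A x)) =
      algTensorMap X A (distTensor A x) := fun n => by
    ext y
    change condExp τ (𝒜 n) _ = _
    rw [algTensorMap_distTensor_apply,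
      (isCondExp_condExp hτ htr (𝒜 n)).proj _ (algebraMap_mem (𝒜 n) _)]
  simp only [ahLip, h, sub_self, enorm_zero, ENNReal.zero_div, ENNReal.iSup_zero, add_zero]
  exact lipConst_distTensor_le x

theorem enorm_atPoint_distTensor (ψ : StateSpace A) (x y : X) :
    ‖ψ.atPoint x (algTensorMap X A (distTensor A x)) -
      ψ.atPoint y (algTensorMap X A (distTensor A x))‖ₑ = edist x y := by
  change ‖ψ (algTensorMap X A (distTensor A x) x) - ψ (algTensorMap X A (distTensor A x) y)‖ₑ = _
  rw [algTensorMap_distTensor_apply, algTensorMap_distTensor_apply, ψ.map_algebraMap,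
    ψ.map_algebraMap, dist_self, Complex.ofReal_zero, zero_sub, enorm_neg, edist_dist,
    ← ofReal_norm, Complex.norm_real, Real.norm_of_nonneg dist_nonneg]

theorem enorm_atPoint_sub_le (ψ : StateSpace A) {f : C(X, A)} (hf : IsSelfAdjoint f)
    (h : lipConst f ≤ 1) (x y : X) : ‖ψ.atPoint x f - ψ.atPoint y f‖ₑ ≤ edist x y := by
  have hfx : ∀ x, IsSelfAdjoint (f x) := fun x => DFunLike.congr_fun hf x
  refine le_trans ?_ (enorm_sub_le_of_lipConst_le_one h x y)
  change ‖ψ (f x) - ψ (f y)‖ₑ ≤ _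
  rw [← map_sub]
  exact enorm_le_iff_norm_le.mpr (ψ.norm_apply_le ((hfx x).sub (hfx y)))

theorem ediam_univ_ne_top : Metric.ediam (Set.univ : Set X) ≠ ⊤ :=
  isCompact_univ.isBounded.ediam_ne_top

/-- The identity, as the state of `ℂ`. -/
def StateSpace.complex : StateSpace ℂ where
  toLinearMap := LinearMap.id
  map_one' := rfl
  nonneg' := star_mul_self_nonneg

theorem StateSpace.complex_isFaithful : StateSpace.complex.IsFaithful := fun a h =>
  (CStarRing.star_mul_self_eq_zero_iff a).mp h

/-- Above, the general oscillation bound applies with `A = ℂ`, whose only state is the identity.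
Below, point evaluations embed `X` isometrically. -/
theorem diameter_mongeKantorovich_lipConst :
    diameter (mongeKantorovich (lipConst (X := X) (A := ℂ))) =
      Metric.ediam (Set.univ : Set X) := by
  apply le_antisymm
  · have key := diameter_mongeKantorovich_le (L := lipConst (X := X) (A := ℂ))
      (r := (Metric.ediam (Set.univ : Set X)).toReal / 2) fun f hf hL =>
        exists_norm_sub_algebraMap_le StateSpace.complex_isFaithful hf ediam_univ_ne_top
          fun θ η x y => by
            have e : ∀ (θ : StateSpace ℂ) (z : ℂ), θ z = z := fun θ z => θ.map_algebraMap z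
            rw [e, e]
            exact (enorm_sub_le_of_lipConst_le_one hL x y).trans
              (Metric.edist_le_ediam_of_mem trivial trivial)
    rwa [mul_div_cancel₀ _ two_ne_zero, ENNReal.ofReal_toReal ediam_univ_ne_top] at key
  · refine Metric.ediam_le fun x _ y _ => ?_
    rw [← enorm_atPoint_distTensor StateSpace.complex x y]
    exact (le_mongeKantorovich ((isSelfAdjoint_distTensor x).map (algTensorMap X ℂ))
      (lipConst_distTensor_le x) _ _).trans (le_diameter _ _ _)

/-- The point and the state are changed one at a time: the Lipschitz summand of `ahLip` pays for the
point, the other summand for the state. -/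
theorem exists_norm_sub_algebraMap_le_of_ahLip_le_one {τ : StateSpace A}
    {𝒜 : ℕ → StarSubalgebra ℂ A} {β : ℕ → ℝ} (hτ : τ.IsFaithful) (htr : τ.IsTracial)
    (h0 : 𝒜 0 = ⊥) (hmono : Monotone 𝒜) [∀ n, FiniteDimensional ℂ (𝒜 n)] (hβ : ∀ n, 0 < β n)
    (hlim : Filter.Tendsto β Filter.atTop (𝓝 0)) {f : C(X, A)} (hf : IsSelfAdjoint f)
    (hL : ahLip τ 𝒜 β f ≤ 1) :
    ∃ c : ℂ, IsSelfAdjoint c ∧ ‖f - algebraMap ℂ C(X, A) c‖ ≤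
      (Metric.ediam (Set.univ : Set X) + diameter (mongeKantorovich (afLip τ 𝒜 β))).toReal / 2 := by
  have hfin := ((diameter_mongeKantorovich_afLip_le hτ htr h0 hβ).trans_lt
    ENNReal.ofReal_lt_top).ne
  have hfx : ∀ x, IsSelfAdjoint (f x) := fun x => DFunLike.congr_fun hf x
  refine exists_norm_sub_algebraMap_le hτ hf (ENNReal.add_ne_top.mpr ⟨ediam_univ_ne_top, hfin⟩)
    fun θ η x y => ?_
  have h1 : ‖θ (f x) - θ (f y)‖ₑ ≤ Metric.ediam (Set.univ : Set X) :=
    (enorm_atPoint_sub_le θ hf (le_self_add.trans hL) x y).trans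
      (Metric.edist_le_ediam_of_mem trivial trivial)
  have h2 : ‖θ (f y) - η (f y)‖ₑ ≤ diameter (mongeKantorovich (afLip τ 𝒜 β)) := by
    refine (enorm_sub_le_mongeKantorovich_afLip hτ htr hmono hβ hlim (hfx y) ?_ θ η).trans
      (le_diameter _ _ _)
    refine le_trans (iSup_mono fun n => ENNReal.div_le_div_right ?_ _)
      (le_add_self.trans hL)
    exact enorm_le_iff_norm_le.mpr ((f - condExpX τ (𝒜 n) f).norm_coe_le_norm y)
  calc ‖θ (f x) - η (f y)‖ₑ = ‖(θ (f x) - θ (f y)) + (θ (f y) - η (f y))‖ₑ := by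
        rw [sub_add_sub_cancel]
    _ ≤ _ := (enorm_add_le _ _).trans (add_le_add h1 h2)

end Lip

/-! ## Uniqueness of the C*-norm on `C(X) ⊗ A` -/

section Nuclear

/-- The map `b ↦ ∑ uᵢ* bᵢ uᵢ` preserves order and sends a constant scalar tuple to that scalar, so
it carries `-r ≤ bᵢ ≤ r` to the sum. -/
theorem CStarAlgebra.norm_sum_conjugate_le {D : Type v} [CStarAlgebra D] {ι : Type*} [Fintype ι]
    {u b : ι → D} (hu : ∑ i, star (u i) * u i = 1) (hb : ∀ i, IsSelfAdjoint (b i)) {r : ℝ}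
    (hr : 0 ≤ r) (hbr : ∀ i, ‖b i‖ ≤ r) : ‖∑ i, star (u i) * b i * u i‖ ≤ r := by
  let _ := CStarAlgebra.spectralOrder D
  have := CStarAlgebra.spectralOrderedRing D
  have hsum : ∀ c : ℝ, ∑ i, star (u i) * algebraMap ℝ D c * u i = algebraMap ℝ D c := fun c => by
    simp_rw [← Algebra.commutes c, mul_assoc]
    rw [← Finset.mul_sum, hu, mul_one]
  have hmono : Monotone (algebraMap ℝ D) := algebraMap_mono D
  refine CStarAlgebra.norm_le_of_mem_Icc (isSelfAdjoint_sum _ fun i _ => (hb i).conjugate' _) hr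
    ⟨?_, ?_⟩
  · rw [← map_neg, ← hsum]
    refine Finset.sum_le_sum fun i _ => star_left_conjugate_le_conjugate ?_ _
    rw [map_neg]
    exact (neg_le_neg (hmono (hbr i))).trans (hb i).neg_algebraMap_norm_le_self
  · rw [← hsum r]
    exact Finset.sum_le_sum fun i _ => star_left_conjugate_le_conjugate
      ((hb i).le_algebraMap_norm_self.trans (hmono (hbr i))) _

variable {X : Type u} [MetricSpace X] [CompactSpace X] {A : Type v} [CStarAlgebra A]

/-- A quadratic partition of unity whose members are supported in small balls. -/
theorem exists_sum_mul_self_eq_one {δ : ℝ} (hδ : 0 < δ) :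
    ∃ (n : ℕ) (u : Fin n → C(X, ℂ)) (x : Fin n → X), (∀ i, IsSelfAdjoint (u i)) ∧
      ∑ i, u i * u i = 1 ∧ ∀ i y, u i y ≠ 0 → dist y (x i) < δ := by
  obtain ⟨t, -, ht, hcov⟩ := Metric.finite_approx_of_totallyBounded
    (isCompact_univ (X := X)).totallyBounded δ hδ
  have := ht.fintype
  let e := (Fintype.equivFin t).symm
  obtain ⟨f, hsub, hone, hmem, -⟩ := exists_continuous_sum_one_of_isOpen_isCompact
    (s := fun i => Metric.ball (e i : X) δ) (fun i => Metric.isOpen_ball) isCompact_univ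
    (fun y hy => by
      obtain ⟨x, hx, hxy⟩ := Set.mem_iUnion₂.mp (hcov hy)
      exact Set.mem_iUnion.mpr ⟨e.symm ⟨x, hx⟩, by simpa using hxy⟩)
  -- Square roots of an ordinary partition of unity.
  refine ⟨_, fun i => ⟨fun y => ((√(f i y) : ℝ) : ℂ), by fun_prop⟩, fun i => e i, fun i => ?_, ?_,
    fun i y hy => ?_⟩
  · ext y
    exact Complex.conj_ofReal _
  · ext y
    have h1 := hone (Set.mem_univ y)
    rw [ContinuousMap.coe_sum, Finset.sum_apply]
    simp only [ContinuousMap.mul_apply, ContinuousMap.coe_mk, ContinuousMap.one_apply,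
      ← Complex.ofReal_mul, Real.mul_self_sqrt (hmem _ y).1]
    simp only [Finset.sum_apply, Pi.one_apply] at h1
    exact_mod_cast h1
  · refine hsub i (subset_tsupport _ fun h => hy ?_)
    simp [h]

/-- In the completion, `uᵢ² ⊗ aᵢ` is the conjugate of `1 ⊗ aᵢ` by `uᵢ ⊗ 1`, so
`CStarAlgebra.norm_sum_conjugate_le` bounds the sum independently of `p`. -/
theorem CStarSeminorm.sum_mul_self_tmul_le [Nonempty X] (p : CStarSeminorm (C(X, ℂ) ⊗[ℂ] A))
    {ι : Type*} [Fintype ι] {u : ι → C(X, ℂ)} (hu : ∀ i, IsSelfAdjoint (u i))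
    (hsum : ∑ i, u i * u i = 1) {a : ι → A} (ha : ∀ i, IsSelfAdjoint (a i)) {r : ℝ} (hr : 0 ≤ r)
    (har : ∀ i, ‖a i‖ ≤ r) : p (∑ i, (u i * u i) ⊗ₜ[ℂ] a i) ≤ r := by
  let j := Completion.ofStarAlg p
  have h1 : ∀ i, j ((u i * u i) ⊗ₜ[ℂ] a i) =
      star (j (u i ⊗ₜ[ℂ] 1)) * j (1 ⊗ₜ[ℂ] a i) * j (u i ⊗ₜ[ℂ] 1) := fun i => by
    rw [← map_star, ← map_mul, ← map_mul, TensorProduct.star_tmul, (hu i).star_eq]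
    simp
  have h2 : ∑ i, star (j (u i ⊗ₜ[ℂ] (1 : A))) * j (u i ⊗ₜ[ℂ] 1) = 1 := by
    have : ∀ i, star (j (u i ⊗ₜ[ℂ] (1 : A))) * j (u i ⊗ₜ[ℂ] 1) =
        j ((u i * u i) ⊗ₜ[ℂ] 1) := fun i => by
      rw [← map_star, ← map_mul, TensorProduct.star_tmul, (hu i).star_eq]
      simp
    simp_rw [this]
    rw [← map_sum, ← TensorProduct.sum_tmul, hsum, ← Algebra.TensorProduct.one_def]
    exact Completion.mk_one p
  rw [← Completion.norm_mk p]
  change ‖j _‖ ≤ r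
  rw [map_sum]
  simp_rw [h1]
  refine CStarAlgebra.norm_sum_conjugate_le h2 (fun i => ?_) hr fun i => ?_
  · refine IsSelfAdjoint.map ?_ j
    rw [IsSelfAdjoint, TensorProduct.star_tmul, star_one, (ha i).star_eq]
  · change ‖Completion.mk p _‖ ≤ r
    rw [Completion.norm_mk]
    refine (p.tmul_le _ _).trans ?_
    rw [norm_one, one_mul]
    exact har i

/-- A function is nearly constant on small balls. For `f ⊗ a` the error is `(f - ∑ f(xᵢ) uᵢ²) ⊗ a`,
small by uniform continuity of `f` and the bound of `p` on elementary tensors; sums of tensors take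
the smaller `δ`. -/
theorem CStarSeminorm.exists_sub_sum_le (p : CStarSeminorm (C(X, ℂ) ⊗[ℂ] A))
    (t : C(X, ℂ) ⊗[ℂ] A) : ∀ ε > 0, ∃ δ > 0, ∀ (n : ℕ) (u : Fin n → C(X, ℂ)) (x : Fin n → X),
      (∀ i, IsSelfAdjoint (u i)) → ∑ i, u i * u i = 1 → (∀ i y, u i y ≠ 0 → dist y (x i) < δ) →
      p (t - ∑ i, (u i * u i) ⊗ₜ[ℂ] (algTensorMap X A t (x i))) ≤ ε := by
  induction t with
  | zero =>
    intro ε hε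
    refine ⟨1, one_pos, fun n u x _ _ _ => ?_⟩
    simpa using (map_zero p.toSeminorm).le.trans hε.le
  | tmul f a =>
    intro ε hε
    have hpos : 0 < ‖a‖ + 1 := by positivity
    obtain ⟨δ, hδ, hf⟩ := Metric.uniformContinuous_iff.mp
      (CompactSpace.uniformContinuous_of_continuous f.continuous) (ε / (‖a‖ + 1)) (by positivity)
    refine ⟨δ, hδ, fun n u x hu hsum hx => ?_⟩
    have e : f ⊗ₜ[ℂ] a - ∑ i, (u i * u i) ⊗ₜ[ℂ] (algTensorMap X A (f ⊗ₜ[ℂ] a) (x i)) =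
        (f - ∑ i, f (x i) • (u i * u i)) ⊗ₜ[ℂ] a := by
      rw [TensorProduct.sub_tmul, TensorProduct.sum_tmul]
      simp_rw [algTensorMap_tmul, TensorProduct.smul_tmul]
    rw [e]
    have hnorm : ‖f - ∑ i, f (x i) • (u i * u i)‖ ≤ ε / (‖a‖ + 1) := by
      rw [ContinuousMap.norm_le _ (by positivity)]
      intro y
      have hsq : ∀ i, u i y * u i y = ((‖u i y‖ ^ 2 : ℝ) : ℂ) := fun i => by
        have h1 : star (u i y) = u i y := DFunLike.congr_fun (hu i) y
        conv_lhs => enter [1]; rw [← h1]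
        rw [Complex.ofReal_pow]
        exact Complex.conj_mul' (u i y)
      have h1 : ∑ i, u i y * u i y = 1 := by
        have := DFunLike.congr_fun hsum y
        rwa [ContinuousMap.coe_sum, Finset.sum_apply] at this
      have h2 : ∑ i, ‖u i y‖ ^ 2 = 1 := by
        simp_rw [hsq] at h1
        exact_mod_cast h1
      have h3 : (f - ∑ i, f (x i) • (u i * u i)) y = ∑ i, (f y - f (x i)) * (u i y * u i y) := by
        rw [ContinuousMap.sub_apply, ContinuousMap.coe_sum, Finset.sum_apply]
        simp_rw [sub_mul]
        rw [Finset.sum_sub_distrib, ← Finset.mul_sum, h1, mul_one]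
        rfl
      rw [h3]
      calc _ ≤ ∑ i, ε / (‖a‖ + 1) * ‖u i y‖ ^ 2 := by
            refine norm_sum_le_of_le _ fun i _ => ?_
            rw [norm_mul, norm_mul, ← sq]
            by_cases h0 : u i y = 0
            · simp [h0]
            · gcongr
              rw [← dist_eq_norm]
              exact (hf (hx i y h0)).le
        _ = _ := by rw [← Finset.mul_sum, h2, mul_one]
    refine (p.tmul_le _ _).trans ?_
    calc _ ≤ ε / (‖a‖ + 1) * (‖a‖ + 1) := by gcongr; linarith
      _ = ε := div_mul_cancel₀ _ hpos.ne'
  | add s t hs ht =>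
    intro ε hε
    obtain ⟨δ, hδ, h⟩ := hs (ε / 2) (half_pos hε)
    obtain ⟨δ', hδ', h'⟩ := ht (ε / 2) (half_pos hε)
    refine ⟨min δ δ', lt_min hδ hδ', fun n u x hu hsum hx => ?_⟩
    have h1 := h n u x hu hsum fun i y hy => (hx i y hy).trans_le (min_le_left _ _)
    have h2 := h' n u x hu hsum fun i y hy => (hx i y hy).trans_le (min_le_right _ _)
    simp_rw [map_add, ContinuousMap.add_apply, TensorProduct.tmul_add]
    rw [Finset.sum_add_distrib, add_sub_add_comm]
    exact (map_add_le_add p.toSeminorm _ _).trans (by linarith)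

/-- A self-adjoint tensor is `p`-close to sums `∑ uᵢ² ⊗ aᵢ` with `aᵢ` among its values, and `p` of
such a sum is at most the supremum norm. The C*-identity then reduces `t` to `t* t`. -/
theorem CStarSeminorm.le_norm_algTensorMap [Nonempty X] (p : CStarSeminorm (C(X, ℂ) ⊗[ℂ] A))
    (t : C(X, ℂ) ⊗[ℂ] A) : p t ≤ ‖algTensorMap X A t‖ := by
  have key : ∀ s : C(X, ℂ) ⊗[ℂ] A, IsSelfAdjoint s → p s ≤ ‖algTensorMap X A s‖ := by
    refine fun s hs => le_of_forall_pos_le_add fun ε hε => ?_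
    obtain ⟨δ, hδ, h⟩ := p.exists_sub_sum_le s ε hε
    obtain ⟨n, u, x, hu, hsum, hx⟩ := exists_sum_mul_self_eq_one (X := X) hδ
    have h1 := h n u x hu hsum hx
    have h2 := p.sum_mul_self_tmul_le hu hsum (a := fun i => algTensorMap X A s (x i))
      (fun i => DFunLike.congr_fun (hs.map (algTensorMap X A)) (x i)) (norm_nonneg _)
      (fun i => (algTensorMap X A s).norm_coe_le_norm (x i))
    have h3 := map_add_le_add p.toSeminorm
      (s - ∑ i, (u i * u i) ⊗ₜ[ℂ] (algTensorMap X A s (x i)))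
      (∑ i, (u i * u i) ⊗ₜ[ℂ] (algTensorMap X A s (x i)))
    rw [sub_add_cancel] at h3
    exact h3.trans (by linarith)
  have h := key (star t * t) (.star_mul_self t)
  rw [p.star_mul_self, map_mul, map_star, CStarRing.norm_star_mul_self] at h
  exact (mul_self_le_mul_self_iff (p.nonneg t) (norm_nonneg _)).mpr h

theorem tensorMap_mk (t : C(X, ℂ) ⊗[ℂ] A) :
    tensorMap X A (CStarSeminorm.Completion.mk _ t) = algTensorMap X A t :=
  CStarSeminorm.Completion.lift_mk _ (norm_algTensorMap_le X A) t

/-- The canonical map from `C(X) ⊗ A` to `C(X, A)` is isometric. -/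
theorem norm_tensorMap [Nonempty X] (z : CStarTensor C(X, ℂ) A) : ‖tensorMap X A z‖ = ‖z‖ := by
  refine CStarSeminorm.Completion.induction _ (P := fun z => ‖tensorMap X A z‖ = ‖z‖)
    (isClosed_eq (CStarSeminorm.Completion.continuous_liftFun _).norm continuous_norm)
    (fun t => ?_) z
  rw [tensorMap_mk, CStarSeminorm.Completion.norm_mk]
  exact le_antisymm (norm_algTensorMap_le X A t) (CStarSeminorm.le_norm_algTensorMap _ t)

end Nuclear

/-! ### The diameter estimates and the isometric copies of `X` -/

theorem theoremt {X : Type u} [MetricSpace X] [CompactSpace X] [Nonempty X]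
    {A : Type v} [CStarAlgebra A]
    (τ : StateSpace A) (hτ_tracial : τ.IsTracial) (hτ_faithful : τ.IsFaithful)
    (𝒜 : ℕ → StarSubalgebra ℂ A) (h𝒜_zero : 𝒜 0 = ⊥) (h𝒜_mono : Monotone 𝒜)
    (h𝒜_fin : ∀ n, FiniteDimensional ℂ (𝒜 n))
    (h𝒜_dense : Dense (⋃ n, (𝒜 n : Set A)))
    (β : ℕ → ℝ) (hβ_pos : ∀ n, 0 < β n) (hβ_lim : Filter.Tendsto β Filter.atTop (𝓝 0)) :
    -- the diameter of the state space of the tensor product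
    diameter (mongeKantorovich (tensorLip (X := X) τ 𝒜 β)) ≤
        diameter (oneMetric (mongeKantorovich (lipConst (X := X) (A := ℂ)))
          (mongeKantorovich (afLip τ 𝒜 β))) ∧
      -- the diameter of the state space of `C(X, A)`
      diameter (mongeKantorovich (ahLip (X := X) τ 𝒜 β)) ≤
        diameter (oneMetric (mongeKantorovich (lipConst (X := X) (A := ℂ)))
          (mongeKantorovich (afLip τ 𝒜 β))) ∧
      -- the diameter of the product of the state spaces
      diameter (oneMetric (mongeKantorovich (lipConst (X := X) (A := ℂ)))
          (mongeKantorovich (afLip τ 𝒜 β))) =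
        diameter (mongeKantorovich (lipConst (X := X) (A := ℂ))) +
          diameter (mongeKantorovich (afLip τ 𝒜 β)) ∧
      diameter (mongeKantorovich (lipConst (X := X) (A := ℂ))) +
          diameter (mongeKantorovich (afLip τ 𝒜 β)) =
        Metric.ediam (Set.univ : Set X) + diameter (mongeKantorovich (afLip τ 𝒜 β)) ∧
      Metric.ediam (Set.univ : Set X) + diameter (mongeKantorovich (afLip τ 𝒜 β)) ≤
        Metric.ediam (Set.univ : Set X) + ENNReal.ofReal (2 * β 0) ∧
      -- isometric copies of `X` in both state spaces
      ∀ (ψ : StateSpace A) (x y : X),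
        mongeKantorovich (ahLip τ 𝒜 β) (ψ.atPoint x) (ψ.atPoint y) = edist x y ∧
        mongeKantorovich (tensorLip τ 𝒜 β) ((ψ.atPoint x).comap (tensorMap X A))
          ((ψ.atPoint y).comap (tensorMap X A)) = edist x y := by
  have hfin : ∀ n, FiniteDimensional ℂ (𝒜 n) := h𝒜_fin
  have hnt : Nontrivial A := ⟨1, 0, fun h => by
    have := τ.map_one
    rw [h, map_zero] at this
    exact zero_ne_one this⟩
  have hball := fun (f : C(X, A)) (hf : IsSelfAdjoint f) (hL : ahLip τ 𝒜 β f ≤ 1) =>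
    exists_norm_sub_algebraMap_le_of_ahLip_le_one hτ_faithful hτ_tracial h𝒜_zero h𝒜_mono hβ_pos
      hβ_lim hf hL
  have hD : Metric.ediam (Set.univ : Set X) + diameter (mongeKantorovich (afLip τ 𝒜 β)) ≠ ⊤ :=
    ENNReal.add_ne_top.mpr ⟨ediam_univ_ne_top,
      ((diameter_mongeKantorovich_afLip_le hτ_faithful hτ_tracial h𝒜_zero hβ_pos).trans_lt
        ENNReal.ofReal_lt_top).ne⟩
  have hne : Nonempty (StateSpace A) := ⟨τ⟩
  have hneX : Nonempty (StateSpace C(X, ℂ)) :=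
    ⟨StateSpace.complex.atPoint (Classical.arbitrary X)⟩
  rw [diameter_oneMetric, diameter_mongeKantorovich_lipConst]
  refine ⟨?_, ?_, rfl, rfl, ?_, fun ψ x y => ⟨?_, ?_⟩⟩
  · have key := diameter_mongeKantorovich_le (L := tensorLip (X := X) τ 𝒜 β) fun t ht hL => by
      obtain ⟨c, hc, hr⟩ := hball _ (ht.map (tensorMap X A)) hL
      refine ⟨c, hc, ?_⟩
      -- The distance to the scalar is transported back through the isometry; its surjectivity plays
      -- no role.
      rw [← norm_tensorMap, map_sub, AlgHomClass.commutes]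
      exact hr
    rwa [mul_div_cancel₀ _ two_ne_zero, ENNReal.ofReal_toReal hD] at key
  · have key := diameter_mongeKantorovich_le (L := ahLip (X := X) τ 𝒜 β) hball
    rwa [mul_div_cancel₀ _ two_ne_zero, ENNReal.ofReal_toReal hD] at key
  · gcongr
    exact diameter_mongeKantorovich_afLip_le hτ_faithful hτ_tracial h𝒜_zero hβ_pos
  · apply le_antisymm
    · exact mongeKantorovich_le fun f hf hL =>
        enorm_atPoint_sub_le ψ hf (le_self_add.trans hL) x y
    · rw [← enorm_atPoint_distTensor ψ x y]
      exact le_mongeKantorovich ((isSelfAdjoint_distTensor x).map (algTensorMap X A))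
        (ahLip_distTensor_le hτ_faithful hτ_tracial 𝒜 β x) _ _
  · apply le_antisymm
    · exact mongeKantorovich_le fun t ht hL =>
        enorm_atPoint_sub_le ψ (ht.map (tensorMap X A)) (le_self_add.trans hL) x y
    -- The test function comes from the algebraic tensor product, so it has an explicit preimage in
    -- the completion.
    · rw [← enorm_atPoint_distTensor ψ x y, ← tensorMap_mk]
      refine le_mongeKantorovich (L := tensorLip τ 𝒜 β) ((isSelfAdjoint_distTensor x).map
        (CStarSeminorm.Completion.ofStarAlg (maxCStarSeminorm C(X, ℂ) A))) ?_ _ _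
      change ahLip τ 𝒜 β (tensorMap X A (CStarSeminorm.Completion.mk _ (distTensor A x))) ≤ 1
      rw [tensorMap_mk]
      exact ahLip_distTensor_le hτ_faithful hτ_tracial 𝒜 β x

end
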